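/- For $r,s\in\mathbb N$ let $w_r(s)=1$ if $s\mid r$ and $w_r(s)=0$ otherwise, and for a group $G$ let $s_r(G)$ denote the number of conjugacy classes of subgroups of order $r$ in $G$. Let $p$ be a prime and let $G=\mathrm{GL}(3,p)$ be the group of invertible $3\times 3$ matrices over the field with $p$ elements. If $p\neq 2$, then $s_2(G)=3$. For every prime $q\neq p$ with $q>2$, \[ s_q(G)=\frac{q^2+4q+9+4\,w_{q-1}(3)}{6}\,w_{p-1}(q)+w_{(p+1)(p^2+p+1)}(q)\,\bigl(1-w_{p-1}(q)\bigr). \] -/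

import Mathlib

/-- The divisibility indicator `w_r(s)`: it is `1` if `s ∣ r` and `0` otherwise. -/
def divInd (r s : ℕ) : ℕ := if s ∣ r then 1 else 0

/-- The subgroups of order `r` of `G`, up to conjugacy: `H` and `K` are related
if and only if `K = g H g⁻¹` for some `g ∈ G`. -/
def subgroupConjSetoid (G : Type*) [Group G] (r : ℕ) :
    Setoid {H : Subgroup G // Nat.card H = r} where
  r H K := ∃ g : G, K.1 = H.1.map (MulAut.conj g).toMonoidHom
  iseqv := by
    refine ⟨fun H => ⟨1, ?_⟩, ?_, ?_⟩
    · ext x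
      simp [Subgroup.mem_map]
    · rintro H K ⟨g, hg⟩
      refine ⟨g⁻¹, ?_⟩
      rw [hg, Subgroup.map_map]
      ext x
      simp [Subgroup.mem_map, mul_assoc]
    · rintro H K L ⟨g, hg⟩ ⟨k, hk⟩
      refine ⟨k * g, ?_⟩
      rw [hk, hg, Subgroup.map_map]
      ext x
      simp [Subgroup.mem_map, mul_assoc]

/-- `s_r(G)`: the number of conjugacy classes of subgroups of order `r` in `G`. -/
noncomputable def numSubgroupClasses (G : Type*) [Group G] (r : ℕ) : ℕ :=
  Nat.card (Quotient (subgroupConjSetoid G r))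

/-! The answer depends on whether the field `𝔽_p` contains the `q`-th roots of unity.

If `q ∣ p - 1`, it does, so every element of order `q` is diagonalizable. A subgroup of order `q` is
then generated by a diagonal matrix with entries `χ (v i)`, where `v` is a nonzero vector in `(ZMod
q)³`. Changing the generator rescales `v`, and conjugacy of diagonal matrices only permutes their
entries. Hence classes correspond to orbits of `(ZMod q)ˣ × S₃` on nonzero vectors
(`numSubgroupClasses_GL_three_of_dvd`), which Burnside's lemma counts for `q > 2`
(`Weights.card_orbits`). The case `q = 2` is a finite check.

If `q ∤ p - 1`, then `|GL(3,p)| = p³(p-1)³(p+1)(p²+p+1)` shows that there is nothing to count unless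
`q` divides `p+1` or `p²+p+1`. It cannot divide both, so a copy of `𝔽_{p²}ˣ` or `𝔽_{p³}ˣ` has index
prime to `q`. Every subgroup of order `q` is conjugate into this cyclic group, which has only one of
that order (`numSubgroupClasses_eq_one`). -/

theorem Subgroup.map_conj_le_of_mem {G : Type*} [Group G] (H C : Subgroup G) (g : G)
    (h : ∀ x ∈ H, g⁻¹ * x * g ∈ C) : H.map (MulAut.conj g⁻¹).toMonoidHom ≤ C := by
  rintro _ ⟨x, hx, rfl⟩
  simpa using h x hx

theorem Subgroup.card_map_conj {G : Type*} [Group G] (H : Subgroup G) (g : G) :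
    Nat.card (H.map (MulAut.conj g).toMonoidHom) = Nat.card H :=
  Subgroup.card_map_of_injective (MulAut.conj g).injective

/-- A `q`-subgroup is conjugate into every subgroup whose index is prime to `q`. -/
theorem Subgroup.exists_map_conj_le_of_not_dvd_index {G : Type*} [Group G] [Finite G] {q : ℕ}
    [Fact q.Prime] (H C : Subgroup G) (hH : IsPGroup q H) (hC : ¬ q ∣ C.index) :
    ∃ g : G, H.map (MulAut.conj g).toMonoidHom ≤ C := by
  -- A coset `gC` is fixed by `H` exactly when `g⁻¹Hg ≤ C`.
  obtain ⟨a, ha⟩ := hH.nonempty_fixed_point_of_prime_not_dvd_card (G ⧸ C) hC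
  induction a using QuotientGroup.induction_on with
  | H g =>
    refine ⟨g⁻¹, Subgroup.map_conj_le_of_mem H C g fun x hx => ?_⟩
    have h1 : ((x * g : G) : G ⧸ C) = (g : G ⧸ C) := ha ⟨x, hx⟩
    have h2 := QuotientGroup.eq.1 h1.symm
    simpa [mul_assoc] using h2

/-- Subgroups of equal order inside a finite cyclic subgroup coincide. -/
theorem Subgroup.eq_of_le_isCyclic {G : Type*} [Group G] [Finite G] (C H K : Subgroup G)
    [IsCyclic C] (hH : H ≤ C) (hK : K ≤ C) (h : Nat.card H = Nat.card K) : H = K := by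
  classical
  have := Fintype.ofFinite C
  -- With `n = |H|`, a cyclic group has at most `n` solutions of `x ^ n = 1`, so a subgroup of order
  -- `n` must be the whole solution set.
  have key : ∀ A : Subgroup G, A ≤ C → Nat.card A = Nat.card H →
      (A.subgroupOf C : Set C) = {x : C | x ^ Nat.card H = 1} := by
    intro A hA hc
    have hcard : Nat.card (A.subgroupOf C) = Nat.card H := by
      rw [← hc]; exact Nat.card_congr (Subgroup.subgroupOfEquivOfLe hA).toEquiv
    refine Set.eq_of_subset_of_ncard_le ?_ ?_ (Set.toFinite _)
    · intro x hx
      have := congrArg Subtype.val (pow_card_eq_one' (x := (⟨x, hx⟩ : A.subgroupOf C)))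
      rwa [hcard] at this
    · have h1 := IsCyclic.card_pow_eq_one_le (α := C) (n := Nat.card H) Nat.card_pos
      have h2 : ({x : C | x ^ Nat.card H = 1} : Set C).ncard
          = (Finset.univ.filter fun x : C => x ^ Nat.card H = 1).card := by
        rw [← Set.ncard_coe_finset]; simp
      rw [h2]
      refine h1.trans (le_of_eq ?_)
      rw [← hcard]; rfl
  have h3 : H.subgroupOf C = K.subgroupOf C := SetLike.coe_injective <| by
    rw [key H hH rfl, key K hK h.symm]
  rw [← Subgroup.map_subgroupOf_eq_of_le hH, ← Subgroup.map_subgroupOf_eq_of_le hK, h3]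

theorem numSubgroupClasses_eq_zero {G : Type*} [Group G] [Finite G] {q : ℕ}
    (hq : ¬ q ∣ Nat.card G) : numSubgroupClasses G q = 0 := by
  have : IsEmpty {H : Subgroup G // Nat.card H = q} :=
    ⟨fun H => hq (H.2 ▸ Subgroup.card_subgroup_dvd_card H.1)⟩
  rw [numSubgroupClasses, Nat.card_eq_zero]
  exact Or.inl inferInstance

/-- A finite group with a cyclic subgroup of index prime to `q` has, up to conjugacy, exactly one
subgroup of order `q`. -/
theorem numSubgroupClasses_eq_one {G : Type*} [Group G] [Finite G] {q : ℕ} [Fact q.Prime]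
    (C : Subgroup G) [IsCyclic C] (hC : ¬ q ∣ C.index) (hG : q ∣ Nat.card G) :
    numSubgroupClasses G q = 1 := by
  rw [numSubgroupClasses, Nat.card_eq_one_iff_unique]
  constructor
  · refine ⟨fun a b => ?_⟩
    induction a using Quotient.inductionOn with | h H =>
    induction b using Quotient.inductionOn with | h K =>
    obtain ⟨H, hH⟩ := H
    obtain ⟨K, hK⟩ := K
    have isP : ∀ A : Subgroup G, Nat.card A = q → IsPGroup q A := fun A hA =>
      IsPGroup.of_card (n := 1) (by rw [hA, pow_one])
    obtain ⟨g, hg⟩ := H.exists_map_conj_le_of_not_dvd_index C (isP H hH) hC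
    obtain ⟨k, hk⟩ := K.exists_map_conj_le_of_not_dvd_index C (isP K hK) hC
    have e := Subgroup.eq_of_le_isCyclic C _ _ hg hk (by
      rw [Subgroup.card_map_conj, Subgroup.card_map_conj, hH, hK])
    have hH' : (subgroupConjSetoid G q).r ⟨H, hH⟩
        ⟨H.map (MulAut.conj g).toMonoidHom, by rw [Subgroup.card_map_conj, hH]⟩ := ⟨g, rfl⟩
    have hK' : (subgroupConjSetoid G q).r ⟨K, hK⟩
        ⟨H.map (MulAut.conj g).toMonoidHom, by rw [Subgroup.card_map_conj, hH]⟩ := ⟨k, e⟩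
    exact Quotient.sound ((subgroupConjSetoid G q).trans hH' ((subgroupConjSetoid G q).symm hK'))
  · obtain ⟨x, hx⟩ := exists_prime_orderOf_dvd_card' q hG
    exact ⟨Quotient.mk _ ⟨Subgroup.zpowers x, by rw [Nat.card_zpowers, hx]⟩⟩

/-! ### The order of `GL(3,p)`, its cyclic tori, and the case `q ∤ p - 1` -/

theorem Nat.card_GL_three (p : ℕ) [Fact p.Prime] :
    Nat.card (Matrix.GeneralLinearGroup (Fin 3) (ZMod p)) =
      (p ^ 3 - 1) * (p ^ 3 - p) * (p ^ 3 - p ^ 2) := by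
  rw [Matrix.card_GL_field, Fin.prod_univ_three]
  simp [ZMod.card]

theorem Nat.card_GL_three' (p : ℕ) [Fact p.Prime] :
    (Nat.card (Matrix.GeneralLinearGroup (Fin 3) (ZMod p)) =
      (p ^ 3 - 1) * (p ^ 3 * (p - 1) ^ 2 * (p + 1))) ∧
    (Nat.card (Matrix.GeneralLinearGroup (Fin 3) (ZMod p)) =
      (p ^ 2 - 1) * (p ^ 3 * (p - 1) ^ 2 * (p ^ 2 + p + 1))) ∧
    Nat.card (Matrix.GeneralLinearGroup (Fin 3) (ZMod p)) =
      p ^ 3 * (p - 1) ^ 3 * ((p + 1) * (p ^ 2 + p + 1)) := by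
  have hp : 1 ≤ p := (Fact.out : p.Prime).one_le
  have h1 : 1 ≤ p ^ 2 := Nat.one_le_pow _ _ hp
  have h2 : 1 ≤ p ^ 3 := Nat.one_le_pow _ _ hp
  have h3 : p ≤ p ^ 3 := Nat.le_self_pow (by norm_num) p
  have h4 : p ^ 2 ≤ p ^ 3 := Nat.pow_le_pow_right hp (by norm_num)
  rw [Nat.card_GL_three]
  zify [hp, h1, h2, h3, h4]
  refine ⟨by ring, by ring, by ring⟩

/-- The group of units of a field `L` embeds into `GL(3, K)` as soon as `L` embeds
multiplicatively into a commutative `K`-algebra of dimension `3`. -/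
theorem exists_isCyclic_subgroup_GL_three {K L A : Type*} [Field K] [Finite K] [Field L] [Finite L]
    [CommRing A] [Algebra K A] [Module.Finite K A] (hA : Module.finrank K A = 3)
    (f : Lˣ →* Aˣ) (hf : Function.Injective f) :
    ∃ C : Subgroup (Matrix.GeneralLinearGroup (Fin 3) K), IsCyclic C ∧
      Nat.card C = Nat.card L - 1 := by
  let b := Module.finBasisOfFinrankEq K A hA
  let g : Lˣ →* Matrix.GeneralLinearGroup (Fin 3) K :=
    (Units.map (Algebra.leftMulMatrix b : A →* Matrix (Fin 3) (Fin 3) K)).comp f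
  have hg : Function.Injective g :=
    (Units.map_injective (Algebra.leftMulMatrix_injective b)).comp hf
  refine ⟨g.range, isCyclic_of_surjective _ g.rangeRestrict_surjective, ?_⟩
  rw [← Nat.card_units, ← Nat.card_congr (g.ofInjective hg).toEquiv]

theorem Nat.Prime.not_dvd_sq_add_add_one_of_dvd_add_one {p q : ℕ} (hq : q.Prime)
    (h1 : q ∣ p + 1) : ¬ q ∣ p ^ 2 + p + 1 := fun h2 => by
  have : q ∣ p * (p + 1) + 1 := by convert h2 using 1; ring
  exact hq.one_lt.ne' (Nat.dvd_one.1 ((Nat.dvd_add_right (h1.mul_left p)).1 this))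

theorem numSubgroupClasses_GL_three_of_not_dvd {p q : ℕ} [Fact p.Prime] [Fact q.Prime]
    (hqp : q ≠ p) (hq : ¬ q ∣ p - 1) :
    numSubgroupClasses (Matrix.GeneralLinearGroup (Fin 3) (ZMod p)) q =
      divInd ((p + 1) * (p ^ 2 + p + 1)) q := by
  have hq' : q.Prime := Fact.out
  have hqp' : ¬ q ∣ p := fun h => hqp ((Nat.prime_dvd_prime_iff_eq hq' Fact.out).1 h)
  have hpow : ∀ m, ¬ q ∣ m → ¬ q ∣ p ^ 3 * (p - 1) ^ 2 * m := fun m hm h => by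
    rcases hq'.dvd_mul.1 h with h | h
    · rcases hq'.dvd_mul.1 h with h | h
      · exact hqp' (hq'.dvd_of_dvd_pow h)
      · exact hq (hq'.dvd_of_dvd_pow h)
    · exact hm h
  obtain ⟨c3, c2, c1⟩ := Nat.card_GL_three' p
  have hp1 : 1 < p := (Fact.out : p.Prime).one_lt
  have index : ∀ (C : Subgroup (Matrix.GeneralLinearGroup (Fin 3) (ZMod p))) (d m : ℕ), d ≠ 0 →
      Nat.card C = p ^ d - 1 →
      Nat.card (Matrix.GeneralLinearGroup (Fin 3) (ZMod p)) = (p ^ d - 1) * m → C.index = m := by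
    intro C d m hd hC hm
    have := C.card_mul_index
    rw [hC, hm] at this
    exact Nat.eq_of_mul_eq_mul_left (by have := Nat.one_lt_pow hd hp1; omega) this
  unfold divInd
  split_ifs with h
  · have hG : q ∣ Nat.card (Matrix.GeneralLinearGroup (Fin 3) (ZMod p)) := by
      rw [c1]; exact h.mul_left _
    rcases hq'.dvd_mul.1 h with h | h
    -- The factor `𝔽_p` pads `𝔽_{p²}` to dimension 3; only the units of the first factor are used.
    · have hA : Module.finrank (ZMod p) (GaloisField p 2 × ZMod p) = 3 := by
        rw [Module.finrank_prod, GaloisField.finrank p two_ne_zero, Module.finrank_self]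
      obtain ⟨C, hC, hc⟩ := exists_isCyclic_subgroup_GL_three hA
        ((MulEquiv.prodUnits (M := GaloisField p 2) (N := ZMod p)).symm.toMonoidHom.comp
          (MonoidHom.inl (GaloisField p 2)ˣ (ZMod p)ˣ))
        (MulEquiv.prodUnits.symm.injective.comp fun x y h => (Prod.ext_iff.1 h).1)
      rw [GaloisField.card p 2 two_ne_zero] at hc
      refine numSubgroupClasses_eq_one C ?_ hG
      rw [index C 2 _ two_ne_zero hc c2]
      exact hpow _ (hq'.not_dvd_sq_add_add_one_of_dvd_add_one h)
    · obtain ⟨C, hC, hc⟩ := exists_isCyclic_subgroup_GL_three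
        (GaloisField.finrank p three_ne_zero) (MonoidHom.id (GaloisField p 3)ˣ)
        Function.injective_id
      rw [GaloisField.card p 3 three_ne_zero] at hc
      refine numSubgroupClasses_eq_one C ?_ hG
      rw [index C 3 _ three_ne_zero hc c3]
      exact hpow _ fun h' => hq'.not_dvd_sq_add_add_one_of_dvd_add_one h' h
  · refine numSubgroupClasses_eq_zero fun h' => ?_
    rw [c1] at h'
    rcases hq'.dvd_mul.1 h' with h' | h'
    · rcases hq'.dvd_mul.1 h' with h' | h'
      · exact hqp' (hq'.dvd_of_dvd_pow h')
      · exact hq (hq'.dvd_of_dvd_pow h')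
    · exact h h'

/-! ### Diagonalization and conjugacy of diagonal matrices -/

open Polynomial in
/-- An endomorphism annihilated by a product of distinct linear factors is diagonalizable. -/
theorem Module.End.exists_basis_eigenvectors {K V : Type*} [Field K] [AddCommGroup V] [Module K V]
    [Module.Finite K V] {n : ℕ} (hn : Module.finrank K V = n) (f : Module.End K V) (s : Finset K)
    (hs : aeval f (∏ c ∈ s, (X - C c)) = 0) :
    ∃ b : Module.Basis (Fin n) K V, ∀ i, ∃ c ∈ s, f (b i) = c • b i := by
  classical
  have ker_le : ∀ t : Finset K, LinearMap.ker (aeval f (∏ c ∈ t, (X - C c))) ≤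
      Submodule.span K {w | ∃ c ∈ t, f w = c • w} := by
    intro t
    induction t using Finset.induction_on with
    | empty => intro v hv; simp at hv; simp [hv]
    | insert a t ha ih =>
      have hco : IsCoprime (X - C a) (∏ c ∈ t, (X - C c)) :=
        IsCoprime.prod_right fun c hc => isCoprime_X_sub_C_of_isUnit_sub
          (sub_ne_zero.2 (ne_of_mem_of_not_mem hc ha).symm).isUnit
      rw [Finset.prod_insert ha, ← sup_ker_aeval_eq_ker_aeval_mul_of_coprime f hco]
      refine sup_le (fun v hv => ?_) (ih.trans (Submodule.span_mono ?_))
      · refine Submodule.subset_span ⟨a, Finset.mem_insert_self a t, ?_⟩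
        simpa [sub_eq_zero, Algebra.algebraMap_eq_smul_one] using hv
      · rintro w ⟨c, hc, hw⟩
        exact ⟨c, Finset.mem_insert_of_mem hc, hw⟩
  have top_le : ⊤ ≤ Submodule.span K {w | ∃ c ∈ s, f w = c • w} := by
    have := ker_le s
    rwa [hs, LinearMap.ker_zero] at this
  let b := Module.Basis.ofSpan top_le
  let e := Fintype.equivFinOfCardEq ((Module.finrank_eq_card_basis b).symm.trans hn)
  refine ⟨b.reindex e, fun i => ?_⟩
  rw [Module.Basis.reindex_apply]
  exact Module.Basis.ofSpan_subset top_le ⟨_, rfl⟩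

/-- Equal multisets of values mean fibres of equal size; bijections between the fibres glue to a
permutation. -/
theorem Fintype.exists_perm_of_map_univ_eq {α β : Type*} [Fintype α] {f g : α → β}
    (h : Finset.univ.val.map f = Finset.univ.val.map g) : ∃ σ : Equiv.Perm α, g ∘ σ = f := by
  classical
  have e : ∀ c, Nonempty ({a // f a = c} ≃ {a // g a = c}) := fun c => by
    have := congrArg (Multiset.count c) h
    rw [Multiset.count_map, Multiset.count_map] at this
    refine ⟨Fintype.equivOfCardEq ?_⟩
    rw [Fintype.card_subtype, Fintype.card_subtype]
    simpa only [eq_comm, Finset.card_def, Finset.filter_val] using this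
  exact ⟨Equiv.ofFiberEquiv fun c => (e c).some, funext fun a => Equiv.ofFiberEquiv_map _ a⟩

namespace Matrix

/-- The diagonal torus of `GL n K`. -/
def diagonalGL (n K : Type*) [Fintype n] [DecidableEq n] [CommRing K] :
    (n → Kˣ) →* GL n K :=
  (Units.map (diagonalRingHom n K : (n → K) →* Matrix n n K)).comp
    (MulEquiv.piUnits (M := fun _ : n => K)).symm.toMonoidHom

variable {n K : Type*} [Fintype n] [DecidableEq n]

theorem coe_diagonalGL [CommRing K] (d : n → Kˣ) :
    (diagonalGL n K d : Matrix n n K) = diagonal fun i => (d i : K) := rfl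

theorem diagonalGL_injective [CommRing K] : Function.Injective (diagonalGL n K) := by
  intro d e h
  have := congrArg (fun g : GL n K => (g : Matrix n n K)) h
  simp only [coe_diagonalGL] at this
  exact funext fun i => Units.ext (congrFun (diagonal_injective this) i)

theorem exists_conj_diagonalGL_eq_comp_perm [CommRing K] (d : n → Kˣ) (σ : Equiv.Perm n) :
    ∃ g : GL n K, g * diagonalGL n K d * g⁻¹ = diagonalGL n K (d ∘ σ) := by
  have hP : IsUnit (σ.permMatrix K) := by
    rw [Matrix.isUnit_iff_isUnit_det, det_permutation]
    exact ((Equiv.Perm.sign σ).map (Int.castRingHom K).toMonoidHom).isUnit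
  obtain ⟨g, hg⟩ := hP
  refine ⟨g, mul_inv_eq_of_eq_mul (Units.ext ?_)⟩
  ext i j
  simp only [Units.val_mul, hg, coe_diagonalGL, diagonal_mul, mul_diagonal, Function.comp]
  by_cases h : σ i = j
  · subst h; ring
  · simp [PEquiv.toMatrix_apply, h]

theorem exists_perm_of_conj_diagonalGL [Field K] {d e : n → Kˣ} {g : GL n K}
    (h : g * diagonalGL n K d * g⁻¹ = diagonalGL n K e) : ∃ σ : Equiv.Perm n, d ∘ σ = e := by
  -- The roots of the characteristic polynomial recover the multiset of diagonal entries.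
  have h1 := congrArg (fun x : GL n K => (x : Matrix n n K).charpoly.roots) h
  have h2 := charpoly_units_conj g (diagonal fun i => (d i : K))
  simp only [Units.val_mul, coe_diagonalGL, coe_units_inv] at h1
  rw [h2, charpoly_diagonal, charpoly_diagonal] at h1
  have h3 : ∀ f : n → K, (∏ i, (Polynomial.X - Polynomial.C (f i))).roots =
      Finset.univ.val.map f := fun f => by
    have := Polynomial.roots_multiset_prod_X_sub_C (Finset.univ.val.map f)
    rwa [Multiset.map_map] at this
  rw [h3, h3] at h1
  obtain ⟨σ, hσ⟩ := Fintype.exists_perm_of_map_univ_eq h1.symm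
  exact ⟨σ, funext fun i => Units.ext (congrFun hσ i)⟩

/-- Over a field with a primitive `q`-th root of unity, matrices with `x ^ q = 1` are conjugate
to diagonal matrices. -/
theorem exists_conj_diagonalGL_of_pow_eq_one {n : ℕ} [Field K] {q : ℕ} (hq : 0 < q) {ζ : K}
    (hζ : IsPrimitiveRoot ζ q) (x : GL (Fin n) K) (hx : x ^ q = 1) :
    ∃ (g : GL (Fin n) K) (d : Fin n → Kˣ), d ^ q = 1 ∧ g * diagonalGL (Fin n) K d * g⁻¹ = x := by
  have ann : Polynomial.aeval (toLin' (x : Matrix (Fin n) (Fin n) K))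
      (∏ c ∈ Polynomial.nthRootsFinset q (1 : K), (Polynomial.X - Polynomial.C c)) = 0 := by
    rw [← Polynomial.X_pow_sub_one_eq_prod hq hζ, map_sub, map_pow, Polynomial.aeval_X, map_one,
      ← toLin'_pow, ← Units.val_pow_eq_pow_val, hx, Units.val_one, toLin'_one]
    exact sub_self _
  obtain ⟨b, hb⟩ := Module.End.exists_basis_eigenvectors (n := n) (by simp) _ _ ann
  choose c hc hbc using hb
  have hcq : ∀ i, c i ^ q = 1 := fun i => (Polynomial.mem_nthRootsFinset hq 1).1 (hc i)
  -- The columns are the eigenvectors.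
  have hP : IsUnit (Matrix.of fun i j => b j i) := by
    rw [← linearIndependent_cols_iff_isUnit]
    exact b.linearIndependent
  obtain ⟨g, hg⟩ := hP
  refine ⟨g, fun i => Units.ofPowEqOne (c i) q (hcq i) hq.ne', ?_, ?_⟩
  · funext i
    exact Units.ext (hcq i)
  · refine mul_inv_eq_of_eq_mul (Units.ext ?_)
    ext i j
    have h1 := congrFun (hbc j) i
    simp only [toLin'_apply, mulVec, dotProduct, Pi.smul_apply, smul_eq_mul] at h1
    rw [Units.val_mul, Units.val_mul, hg, coe_diagonalGL, mul_diagonal, mul_apply]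
    simp only [of_apply, Units.val_ofPowEqOne]
    rw [h1, mul_comm]

end Matrix

/-! ### Burnside count of the orbits of weight vectors -/

/-- The nonzero vectors of weights of the three diagonal entries. -/
abbrev Weights (q : ℕ) : Type := {v : Fin 3 → ZMod q // v ≠ 0}

/-- Scalars and permutations of the coordinates act on the nonzero weight vectors. -/
instance weightsMulAction (q : ℕ) : MulAction ((ZMod q)ˣ × Equiv.Perm (Fin 3)) (Weights q) where
  smul g v := ⟨fun i => g.1 * v.1 (g.2⁻¹ i), fun h => v.2 <| funext fun i => by
    have := congrFun h (g.2 i)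
    simpa using this⟩
  one_smul v := Subtype.ext <| funext fun i => one_mul _
  mul_smul g h v := Subtype.ext <| funext fun i => mul_assoc (g.1 : ZMod q) h.1 _

theorem Weights.smul_apply {q : ℕ} (g : (ZMod q)ˣ × Equiv.Perm (Fin 3)) (v : Weights q)
    (i : Fin 3) : (g • v).1 i = g.1 * v.1 (g.2⁻¹ i) := rfl

theorem Nat.card_subtype_ne_zero_and {V : Type*} [Zero V] [Finite V] {P : V → Prop} (h0 : P 0) :
    (Nat.card {v : {v : V // v ≠ 0} // P v.1} : ℤ) = Nat.card {v : V // P v} - 1 := by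
  classical
  have := Fintype.ofFinite V
  have e : {v : {v : V // v ≠ 0} // P v.1} ≃ {v : V // v ≠ 0 ∧ P v} :=
    Equiv.subtypeSubtypeEquivSubtypeInter _ _
  rw [Nat.card_congr e, Nat.card_eq_fintype_card, Nat.card_eq_fintype_card, Fintype.card_subtype,
    Fintype.card_subtype]
  have : (Finset.univ.filter P) = insert 0 (Finset.univ.filter fun v => v ≠ 0 ∧ P v) := by
    ext v
    by_cases h : v = 0 <;> simp [h, h0]
  rw [this, Finset.card_insert_of_notMem (by simp)]
  simp

section
variable {q : ℕ} [Fact q.Prime]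

open Classical in
theorem card_solutions_one (u : (ZMod q)ˣ) :
    (Nat.card {v : Fin 3 → ZMod q // ∀ x, u * v x = v x} : ℤ) - 1 =
      if u = 1 then (q : ℤ) ^ 3 - 1 else 0 := by
  split_ifs with hu
  · simp [hu]
  · have : ∀ v : Fin 3 → ZMod q, (∀ x, u * v x = v x) ↔ v = 0 := fun v => by
      refine ⟨fun h => funext fun x => ?_, fun h => by simp [h]⟩
      by_contra hx
      exact hu (Units.ext ((mul_eq_right₀ hx).1 (h x)))
    simp [this]

open Classical in
-- Applying the relation twice gives `u² = 1` unless `v i = v j = 0`. For `u = 1` the entries `v i =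
-- v j` and `v k` are free; for `u = -1` only `v i = -v j` is. These cases are distinct because `q >
-- 2`.
theorem card_solutions_transposition (hq : 2 < q) (u : (ZMod q)ˣ) {τ : Fin 3 → Fin 3}
    {i j k : Fin 3} (hij : j ≠ i) (hik : k ≠ i) (hjk : k ≠ j) (hc : ∀ x, x = i ∨ x = j ∨ x = k)
    (hi : τ i = j) (hj : τ j = i) (hk : τ k = k) :
    (Nat.card {v : Fin 3 → ZMod q // ∀ x, u * v (τ x) = v x} : ℤ) - 1 =
      (if u = 1 then (q : ℤ) ^ 2 - 1 else 0) + if u = -1 then (q : ℤ) - 1 else 0 := by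
  have : Fact (2 < q) := ⟨hq⟩
  have hforall : ∀ v : Fin 3 → ZMod q,
      (∀ x, u * v (τ x) = v x) ↔ u * v j = v i ∧ u * v i = v j ∧ u * v k = v k := by
    refine fun v => ⟨fun h => ⟨hi ▸ h i, hj ▸ h j, ?_⟩, fun ⟨h1, h2, h3⟩ x => ?_⟩
    · have := h k; rwa [hk] at this
    · rcases hc x with h | h | h <;> rw [h]
      · rwa [hi]
      · rwa [hj]
      · rwa [hk]
  simp only [hforall]
  have hne : (1 : (ZMod q)ˣ) ≠ -1 := fun h => ZMod.neg_one_ne_one (n := q) (by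
    simpa using (congrArg Units.val h).symm)
  by_cases h1 : u = 1
  · have bij : Function.Bijective (fun v : {v : Fin 3 → ZMod q //
        u * v j = v i ∧ u * v i = v j ∧ u * v k = v k} => (v.1 i, v.1 k)) := by
      constructor
      · rintro ⟨v, hv⟩ ⟨w, hw⟩ h
        simp only [Prod.mk.injEq] at h
        refine Subtype.ext (funext fun x => ?_)
        change v x = w x
        rcases hc x with hx | hx | hx <;> rw [hx]
        · exact h.1
        · rw [← hv.2.1, ← hw.2.1, h.1]
        · exact h.2
      · rintro ⟨a, b⟩
        exact ⟨⟨fun x => if x = k then b else a, by simp [h1, hik.symm, hjk.symm]⟩,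
          by simp [hik.symm]⟩
    rw [Nat.card_congr (Equiv.ofBijective _ bij), if_pos h1, if_neg (h1 ▸ hne)]
    simp [pow_two]
  have hk0 : ∀ v : Fin 3 → ZMod q, u * v k = v k → v k = 0 := fun v h => by
    by_contra hx
    exact h1 (Units.ext ((mul_eq_right₀ hx).1 h))
  by_cases h2 : u = -1
  · have bij : Function.Bijective (fun v : {v : Fin 3 → ZMod q //
        u * v j = v i ∧ u * v i = v j ∧ u * v k = v k} => v.1 i) := by
      constructor
      · rintro ⟨v, hv⟩ ⟨w, hw⟩ h
        refine Subtype.ext (funext fun x => ?_)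
        change v x = w x
        rcases hc x with hx | hx | hx <;> rw [hx]
        · exact h
        · rw [← hv.2.1, ← hw.2.1]; exact congrArg _ h
        · rw [hk0 v hv.2.2, hk0 w hw.2.2]
      · intro a
        exact ⟨⟨fun x => if x = i then a else if x = j then -a else 0,
          by simp [h2, hij, hik, hjk]⟩, by simp⟩
    rw [Nat.card_congr (Equiv.ofBijective _ bij), if_neg h1, if_pos h2]
    simp
  · have : ∀ v : Fin 3 → ZMod q, (u * v j = v i ∧ u * v i = v j ∧ u * v k = v k) ↔ v = 0 := by
      refine fun v => ⟨fun ⟨a, b, c⟩ => ?_, fun h => by simp [h]⟩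
      have hi0 : v i = 0 := by
        by_contra hx
        have : (u : ZMod q) * u = 1 := by
          rw [← b, ← mul_assoc] at a
          exact (mul_eq_right₀ hx).1 a
        rcases mul_self_eq_one_iff.1 this with h | h
        · exact h1 (Units.ext h)
        · exact h2 (Units.ext (by simpa using h))
      refine funext fun x => ?_
      rcases hc x with hx | hx | hx <;> rw [hx]
      · exact hi0
      · rw [← b, hi0]; simp
      · exact hk0 v c
    simp [this, h1, h2]

open Classical in
-- Going once round the cycle gives `u³ v i = v i`, and `v i` determines the other entries.
theorem card_solutions_cycle (u : (ZMod q)ˣ) {τ : Fin 3 → Fin 3}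
    {i j k : Fin 3} (hij : j ≠ i) (hik : k ≠ i) (hjk : k ≠ j) (hc : ∀ x, x = i ∨ x = j ∨ x = k)
    (hi : τ i = j) (hj : τ j = k) (hk : τ k = i) :
    (Nat.card {v : Fin 3 → ZMod q // ∀ x, u * v (τ x) = v x} : ℤ) - 1 =
      if u ^ 3 = 1 then (q : ℤ) - 1 else 0 := by
  have hforall : ∀ v : Fin 3 → ZMod q,
      (∀ x, u * v (τ x) = v x) ↔ u * v j = v i ∧ u * v k = v j ∧ u * v i = v k := by
    refine fun v => ⟨fun h => ⟨hi ▸ h i, hj ▸ h j, hk ▸ h k⟩, fun ⟨h1, h2, h3⟩ x => ?_⟩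
    rcases hc x with h | h | h <;> rw [h]
    · rwa [hi]
    · rwa [hj]
    · rwa [hk]
  simp only [hforall]
  split_ifs with h
  · have h' : (u : ZMod q) ^ 3 = 1 := by
      rw [← Units.val_pow_eq_pow_val, h, Units.val_one]
    have bij : Function.Bijective (fun v : {v : Fin 3 → ZMod q //
        u * v j = v i ∧ u * v k = v j ∧ u * v i = v k} => v.1 i) := by
      constructor
      · rintro ⟨v, hv⟩ ⟨w, hw⟩ h
        refine Subtype.ext (funext fun x => ?_)
        change v x = w x
        simp only at h
        rcases hc x with hx | hx | hx <;> rw [hx]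
        · exact h
        · rw [← hv.2.1, ← hw.2.1, ← hv.2.2, ← hw.2.2, h]
        · rw [← hv.2.2, ← hw.2.2, h]
      · intro a
        refine ⟨⟨fun x => if x = i then a else if x = j then u ^ 2 * a else u * a, ?_⟩, by simp⟩
        simp only [hij, hik, hjk, if_true, if_false, and_true]
        exact ⟨by linear_combination a * h', by ring⟩
    rw [Nat.card_congr (Equiv.ofBijective _ bij)]
    simp
  · have : ∀ v : Fin 3 → ZMod q, (u * v j = v i ∧ u * v k = v j ∧ u * v i = v k) ↔ v = 0 := by
      refine fun v => ⟨fun ⟨a, b, c⟩ => ?_, fun h => by simp [h]⟩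
      have hi0 : v i = 0 := by
        by_contra hx
        rw [← b, ← c, ← mul_assoc, ← mul_assoc] at a
        refine h (Units.ext (Eq.trans ?_ ((mul_eq_right₀ hx).1 a)))
        rw [Units.val_pow_eq_pow_val]
        ring
      refine funext fun x => ?_
      rcases hc x with hx | hx | hx <;> rw [hx]
      · exact hi0
      · rw [← b, ← c, hi0]; simp
      · rw [← c, hi0]; simp
    simp [this]

theorem Weights.card_fixedBy (u : (ZMod q)ˣ) (σ : Equiv.Perm (Fin 3)) :
    (Nat.card (MulAction.fixedBy (Weights q) (u, σ)) : ℤ) =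
      Nat.card {v : Fin 3 → ZMod q // ∀ x, u * v (σ⁻¹ x) = v x} - 1 := by
  rw [← Nat.card_subtype_ne_zero_and (by simp)]
  refine congrArg _ (Nat.card_congr (Equiv.subtypeEquivRight fun v => ?_))
  rw [MulAction.mem_fixedBy, Subtype.ext_iff, funext_iff]
  rfl

/-- Burnside's lemma, with the group of order `6(q - 1)` sorted by cycle type: the identity, three
transpositions, two 3-cycles. The gcd is the number of cube roots of unity in `(ZMod q)ˣ`. -/
theorem Weights.card_orbits_mul (hq : 2 < q) :
    (Nat.card (MulAction.orbitRel.Quotient ((ZMod q)ˣ × Equiv.Perm (Fin 3)) (Weights q)) : ℤ) *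
      (6 * (q - 1)) =
      q ^ 3 - 1 + 3 * (q ^ 2 - 1 + (q - 1)) + 2 * ((q - 1) * (Nat.gcd (q - 1) 3 : ℕ)) := by
  classical
  have hburn := MulAction.sum_card_fixedBy_eq_card_orbits_mul_card_group
    ((ZMod q)ˣ × Equiv.Perm (Fin 3)) (Weights q)
  have hq1 : 1 ≤ q := by omega
  have hG : Fintype.card ((ZMod q)ˣ × Equiv.Perm (Fin 3)) = (q - 1) * 6 := by
    rw [Fintype.card_prod, Fintype.card_perm, ZMod.card_units]; rfl
  rw [hG, Fintype.sum_prod_type_right] at hburn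
  have huniv : (Finset.univ : Finset (Equiv.Perm (Fin 3))) =
      {1, Equiv.swap 0 1, Equiv.swap 0 2, Equiv.swap 1 2, finRotate 3, (finRotate 3)⁻¹} := by decide
  have hb := congrArg (Nat.cast : ℕ → ℤ) hburn
  have hcube : (Finset.univ.filter fun u : (ZMod q)ˣ => u ^ 3 = 1).card = Nat.gcd (q - 1) 3 := by
    have h := IsCyclic.card_powMonoidHom_ker (ZMod q)ˣ 3
    rw [Nat.card_eq_fintype_card (α := (ZMod q)ˣ), ZMod.card_units] at h
    rw [← h, ← Fintype.card_subtype, ← Nat.card_eq_fintype_card]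
    rfl
  have h1 : ∑ u : (ZMod q)ˣ,
      (Nat.card (MulAction.fixedBy (Weights q) (u, (1 : Equiv.Perm (Fin 3)))) : ℤ)
      = q ^ 3 - 1 := by
    rw [Finset.sum_congr rfl fun u _ => (Weights.card_fixedBy u 1).trans (card_solutions_one u)]
    simp
  have h2 : ∀ σ : Equiv.Perm (Fin 3),
      σ ∈ ({Equiv.swap 0 1, Equiv.swap 0 2, Equiv.swap 1 2} : Finset (Equiv.Perm (Fin 3))) →
      ∑ u : (ZMod q)ˣ, (Nat.card (MulAction.fixedBy (Weights q) (u, σ)) : ℤ)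
      = q ^ 2 - 1 + (q - 1) := by
    intro σ hσ
    obtain ⟨i, j, k, hij, hik, hjk, hc, hi, hj, hk⟩ : ∃ i j k : Fin 3, j ≠ i ∧ k ≠ i ∧ k ≠ j ∧
        (∀ x, x = i ∨ x = j ∨ x = k) ∧ σ⁻¹ i = j ∧ σ⁻¹ j = i ∧ σ⁻¹ k = k := by
      revert σ; decide
    rw [Finset.sum_congr rfl fun u _ => (Weights.card_fixedBy u σ).trans
      (card_solutions_transposition hq u hij hik hjk hc hi hj hk), Finset.sum_add_distrib]
    simp
  have h3 : ∀ σ : Equiv.Perm (Fin 3),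
      σ ∈ ({finRotate 3, (finRotate 3)⁻¹} : Finset (Equiv.Perm (Fin 3))) →
      ∑ u : (ZMod q)ˣ, (Nat.card (MulAction.fixedBy (Weights q) (u, σ)) : ℤ)
      = (q - 1) * (Nat.gcd (q - 1) 3 : ℕ) := by
    intro σ hσ
    obtain ⟨i, j, k, hij, hik, hjk, hc, hi, hj, hk⟩ : ∃ i j k : Fin 3, j ≠ i ∧ k ≠ i ∧ k ≠ j ∧
        (∀ x, x = i ∨ x = j ∨ x = k) ∧ σ⁻¹ i = j ∧ σ⁻¹ j = k ∧ σ⁻¹ k = i := by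
      revert σ; decide
    rw [Finset.sum_congr rfl fun u _ => (Weights.card_fixedBy u σ).trans
      (card_solutions_cycle u hij hik hjk hc hi hj hk), ← Finset.sum_filter, Finset.sum_const, hcube,
      nsmul_eq_mul, mul_comm]
  rw [huniv, Finset.sum_insert (by decide), Finset.sum_insert (by decide),
    Finset.sum_insert (by decide), Finset.sum_insert (by decide), Finset.sum_insert (by decide),
    Finset.sum_singleton] at hb
  simp only [← Nat.card_eq_fintype_card] at hb
  push_cast [hq1] at hb
  rw [h1, h2 _ (by decide), h2 _ (by decide), h2 _ (by decide), h3 _ (by decide),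
    h3 _ (by decide)] at hb
  rw [show (6 : ℤ) * (q - 1) = (q - 1) * 6 by ring]
  exact hb.symm.trans (by ring)

theorem Weights.card_orbits (hq : 2 < q) :
    (Nat.card (MulAction.orbitRel.Quotient ((ZMod q)ˣ × Equiv.Perm (Fin 3)) (Weights q)) : ℚ) =
      ((q : ℚ) ^ 2 + 4 * q + 9 + 4 * divInd (q - 1) 3) / 6 := by
  have h := congrArg (Int.cast : ℤ → ℚ) (Weights.card_orbits_mul hq)
  have hg : (Nat.gcd (q - 1) 3 : ℚ) = 1 + 2 * divInd (q - 1) 3 := by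
    unfold divInd
    split_ifs with h3
    · rw [Nat.gcd_eq_right h3]; norm_num
    · rw [Nat.Coprime.gcd_eq_one ((Nat.Prime.coprime_iff_not_dvd Nat.prime_three).2 h3).symm]
      norm_num
  push_cast at h
  rw [hg] at h
  have hq1 : (q : ℚ) - 1 ≠ 0 := by
    have : (2 : ℚ) < q := by exact_mod_cast hq
    linarith
  refine mul_right_cancel₀ hq1 ?_
  linear_combination h / 6

end

/-- Lets the orbits of the seven nonzero vectors be counted by evaluation; for `q = 2` the general
count breaks down since `-1 = 1`. -/
instance : DecidableRel
    (MulAction.orbitRel ((ZMod 2)ˣ × Equiv.Perm (Fin 3)) (Weights 2)).r :=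
  fun a b => inferInstanceAs (Decidable (∃ g : (ZMod 2)ˣ × Equiv.Perm (Fin 3), g • b = a))

theorem Weights.card_orbits_two :
    Nat.card (MulAction.orbitRel.Quotient ((ZMod 2)ˣ × Equiv.Perm (Fin 3)) (Weights 2)) = 3 := by
  rw [Nat.card_eq_fintype_card]
  decide

/-! ### Weight vectors and subgroups of order `q`: the case `q ∣ p - 1` -/

theorem IsPrimitiveRoot.exists_zmod_hom {R : Type*} [CommRing R] [IsDomain R] {q : ℕ} [NeZero q]
    {ζ : Rˣ} (h : IsPrimitiveRoot ζ q) :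
    ∃ χ : Multiplicative (ZMod q) →* Rˣ, Function.Injective χ ∧
      ∀ y : Rˣ, y ^ q = 1 → ∃ a, χ a = y := by
  refine ⟨(Subgroup.zpowers ζ).subtype.comp (AddMonoidHom.toMultiplicativeLeft
    h.zmodEquivZPowers.toAddMonoidHom), ?_, fun y hy => ?_⟩
  · exact Subtype.val_injective.comp h.zmodEquivZPowers.injective
  · have : y ∈ Subgroup.zpowers ζ := by rw [h.zpowers_eq]; exact hy
    obtain ⟨a, ha⟩ := h.zmodEquivZPowers.surjective (Additive.ofMul ⟨y, this⟩)
    exact ⟨Multiplicative.ofAdd a, congrArg (fun z => (Additive.toMul z).1) ha⟩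

section
variable {K : Type*} [Field K] {q : ℕ} (χ : Multiplicative (ZMod q) →* Kˣ)

/-- The diagonal matrix with entries `χ (v i)`. -/
def weightMatrix (v : Fin 3 → ZMod q) : Matrix.GeneralLinearGroup (Fin 3) K :=
  Matrix.diagonalGL (Fin 3) K fun i => χ (Multiplicative.ofAdd (v i))

theorem weightMatrix_pow (v : Fin 3 → ZMod q) (n : ℕ) :
    weightMatrix χ v ^ n = weightMatrix χ fun i => n * v i := by
  rw [weightMatrix, ← map_pow]
  refine congrArg _ (funext fun i => ?_)
  rw [Pi.pow_apply, ← map_pow, ← ofAdd_nsmul, nsmul_eq_mul]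

theorem weightMatrix_zero : weightMatrix χ 0 = 1 := by
  rw [← map_one (Matrix.diagonalGL (Fin 3) K)]
  exact congrArg _ (funext fun i => map_one χ)

theorem weightMatrix_pow_eq_one (v : Fin 3 → ZMod q) : weightMatrix χ v ^ q = 1 := by
  rw [weightMatrix_pow, ← weightMatrix_zero χ]
  exact congrArg _ (funext fun i => by simp)

variable {χ}

theorem weightMatrix_injective (hχ : Function.Injective χ) :
    Function.Injective (weightMatrix χ) := fun _ _ h =>
  funext fun i => Multiplicative.ofAdd.injective
    (hχ (congrFun (Matrix.diagonalGL_injective h) i))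

variable [Fact q.Prime]

theorem orderOf_weightMatrix (hχ : Function.Injective χ) (v : Weights q) :
    orderOf (weightMatrix χ v.1) = q :=
  orderOf_eq_prime (weightMatrix_pow_eq_one χ v.1) fun h => v.2 (weightMatrix_injective hχ (h.trans
    (weightMatrix_zero χ).symm))

/-- The cyclic group of order `q` generated by the diagonal matrix with weights `v`. -/
def weightSubgroup (hχ : Function.Injective χ) (v : Weights q) :
    {H : Subgroup (Matrix.GeneralLinearGroup (Fin 3) K) // Nat.card H = q} :=
  ⟨Subgroup.zpowers (weightMatrix χ v.1), by
    rw [Nat.card_zpowers, orderOf_weightMatrix hχ]⟩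

theorem weightSubgroup_map_conj (hχ : Function.Injective χ) (v : Weights q)
    (g : Matrix.GeneralLinearGroup (Fin 3) K) :
    (weightSubgroup hχ v).1.map (MulAut.conj g).toMonoidHom =
      Subgroup.zpowers (g * weightMatrix χ v.1 * g⁻¹) := MonoidHom.map_zpowers _ _

theorem weightSubgroup_conj_iff (hχ : Function.Injective χ) (v w : Weights q) :
    (subgroupConjSetoid _ q).r (weightSubgroup hχ v) (weightSubgroup hχ w) ↔
      ∃ g : (ZMod q)ˣ × Equiv.Perm (Fin 3), g • v = w := by
  constructor
  · rintro ⟨g, hg⟩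
    rw [weightSubgroup_map_conj] at hg
    have hmem : weightMatrix χ w.1 ∈ Subgroup.zpowers (g * weightMatrix χ v.1 * g⁻¹) :=
      hg ▸ Subgroup.mem_zpowers _
    have hfin : IsOfFinOrder (g * weightMatrix χ v.1 * g⁻¹) := by
      refine isOfFinOrder_iff_pow_eq_one.2 ⟨q, (Fact.out : q.Prime).pos, ?_⟩
      rw [conj_pow, weightMatrix_pow_eq_one]; simp
    -- The exponent relating the two generators, read modulo `q`, is the scalar that acts on the
    -- weights.
    obtain ⟨n, hn⟩ := hfin.mem_powers_iff_mem_zpowers.2 hmem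
    simp only [conj_pow] at hn
    rw [weightMatrix_pow] at hn
    have hn0 : (n : ZMod q) ≠ 0 := fun h => by
      refine w.2 (weightMatrix_injective hχ (hn.symm.trans ?_))
      simp only [h, zero_mul]
      rw [← Pi.zero_def, weightMatrix_zero]; simp
    obtain ⟨σ, hσ⟩ := Matrix.exists_perm_of_conj_diagonalGL hn
    refine ⟨(Units.mk0 _ hn0, σ⁻¹), Subtype.ext (funext fun i => ?_)⟩
    rw [Weights.smul_apply, inv_inv]
    exact Multiplicative.ofAdd.injective (hχ (congrFun hσ i))
  · rintro ⟨⟨u, σ⟩, rfl⟩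
    obtain ⟨g, hg⟩ := Matrix.exists_conj_diagonalGL_eq_comp_perm
      (fun i => χ (Multiplicative.ofAdd (u * v.1 i))) σ⁻¹
    refine ⟨g, ?_⟩
    rw [weightSubgroup_map_conj]
    have hpow : (g * weightMatrix χ v.1 * g⁻¹) ^ (u : ZMod q).val =
        weightMatrix χ ((u, σ) • v).1 := by
      rw [conj_pow, weightMatrix_pow, ZMod.natCast_zmod_val]
      exact hg
    have hcard : Nat.card (Subgroup.zpowers (g * weightMatrix χ v.1 * g⁻¹)) = q := by
      rw [← weightSubgroup_map_conj hχ, Subgroup.card_map_conj, (weightSubgroup hχ v).2]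
    have : Finite (Subgroup.zpowers (g * weightMatrix χ v.1 * g⁻¹)) :=
      Nat.finite_of_card_ne_zero (hcard.trans_ne (Fact.out : q.Prime).ne_zero)
    refine Subgroup.eq_of_le_of_card_ge ?_ ?_
    · refine Subgroup.zpowers_le.2 ?_
      rw [← hpow]
      exact Subgroup.npow_mem_zpowers _ _
    · rw [hcard, (weightSubgroup hχ _).2]

theorem numSubgroupClasses_GL_three_of_dvd [Finite K] {p : ℕ} (hp : Nat.card K - 1 = p) (h : q ∣ p) :
    numSubgroupClasses (Matrix.GeneralLinearGroup (Fin 3) K) q =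
      Nat.card (MulAction.orbitRel.Quotient ((ZMod q)ˣ × Equiv.Perm (Fin 3)) (Weights q)) := by
  have hq : q.Prime := Fact.out
  obtain ⟨ζ, hζ⟩ : ∃ ζ : Kˣ, IsPrimitiveRoot ζ q := by
    obtain ⟨ζ, hζ⟩ := exists_prime_orderOf_dvd_card' (G := Kˣ) q (by rwa [Nat.card_units, hp])
    exact ⟨ζ, hζ ▸ IsPrimitiveRoot.orderOf ζ⟩
  obtain ⟨χ, hχ, hsurj⟩ := hζ.exists_zmod_hom
  refine (Nat.card_congr (Equiv.ofBijective (Quotient.map (weightSubgroup hχ)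
    fun v w hvw => ?_) ⟨?_, ?_⟩)).symm
  · obtain ⟨g, hg⟩ := MulAction.orbitRel_apply.1 ((MulAction.orbitRel _ _).symm hvw)
    exact (weightSubgroup_conj_iff hχ v w).2 ⟨g, hg⟩
  · intro a b
    induction a using Quotient.inductionOn with | h v =>
    induction b using Quotient.inductionOn with | h w =>
    intro hab
    have := (weightSubgroup_conj_iff hχ v w).1 (Quotient.exact hab)
    exact Quotient.sound ((MulAction.orbitRel _ _).symm (MulAction.orbitRel_apply.2 this))
  · intro a
    induction a using Quotient.inductionOn with | h H =>
    obtain ⟨H, hH⟩ := H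
    have : Finite H := Nat.finite_of_card_ne_zero (hH ▸ hq.ne_zero)
    have hcyc : IsCyclic H := isCyclic_of_prime_card hH
    obtain ⟨x, rfl⟩ := (Subgroup.isCyclic_iff_exists_zpowers_eq_top H).1 hcyc
    have hx : x ^ q = 1 := by
      rw [← hH, Nat.card_zpowers, pow_orderOf_eq_one]
    obtain ⟨g, d, hd, hgd⟩ := Matrix.exists_conj_diagonalGL_of_pow_eq_one hq.pos
      (IsPrimitiveRoot.coe_units_iff.2 hζ) x hx
    choose a ha using fun i => hsurj (d i) (congrFun hd i)
    have hv : weightMatrix χ (fun i => (a i).toAdd) = Matrix.diagonalGL (Fin 3) K d :=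
      congrArg _ (funext ha)
    -- Zero weights would make the generator trivial, against order `q`.
    have hv0 : (fun i => (a i).toAdd) ≠ 0 := fun h0 => by
      rw [h0, weightMatrix_zero] at hv
      rw [← hv] at hgd
      rw [Nat.card_zpowers, ← hgd] at hH
      simp at hH
      exact hq.one_lt.ne hH
    refine ⟨Quotient.mk _ ⟨_, hv0⟩, Quotient.sound ⟨g, ?_⟩⟩
    rw [← hv] at hgd
    exact (congrArg Subgroup.zpowers hgd.symm).trans (weightSubgroup_map_conj hχ ⟨_, hv0⟩ g).symm
end

theorem mainTheorem7 (p : ℕ) (hp : p.Prime) :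
    (p ≠ 2 → numSubgroupClasses (Matrix.GeneralLinearGroup (Fin 3) (ZMod p)) 2 = 3) ∧
    ∀ q : ℕ, q.Prime → q ≠ p → 2 < q →
      (numSubgroupClasses (Matrix.GeneralLinearGroup (Fin 3) (ZMod p)) q : ℚ) =
        ((q : ℚ) ^ 2 + 4 * q + 9 + 4 * divInd (q - 1) 3) / 6 * divInd (p - 1) q
          + divInd ((p + 1) * (p ^ 2 + p + 1)) q * (1 - (divInd (p - 1) q : ℚ)) := by
  have : Fact p.Prime := ⟨hp⟩
  have hcard : Nat.card (ZMod p) - 1 = p - 1 := by rw [Nat.card_zmod]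
  refine ⟨fun h2 => ?_, fun q hq hqp hq2 => ?_⟩
  · rw [numSubgroupClasses_GL_three_of_dvd hcard (hp.even_sub_one h2).two_dvd,
      Weights.card_orbits_two]
  · have : Fact q.Prime := ⟨hq⟩
    by_cases hd : q ∣ p - 1
    · rw [numSubgroupClasses_GL_three_of_dvd hcard hd, Weights.card_orbits hq2]
      simp [divInd, hd]
    · rw [numSubgroupClasses_GL_three_of_not_dvd hqp hd]
      simp [divInd, hd]
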